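/- Call a pair $(u,v)$ of elements of a group a \emph{free pair} if $u$ and $v$ freely generate a (non-abelian) free group, and call $z\in\mathbb{C}$ a \emph{free point} if $\left(\begin{pmatrix}1&1\\0&1\end{pmatrix},\begin{pmatrix}1&0\\z&1\end{pmatrix}\right)$ is a free pair. Let $G$ be a finite group all of whose irreducible complex characters have degree at most $3$, and extend every character of $G$ linearly to the complex group algebra $\mathbb{C}G$. Let $a,b\in\mathbb{C}G$ satisfy $a^2=b^2=0$, so that $1+a$ and $1+b$ are units of $\mathbb{C}G$. Then: (1) $(1+a,1+b)$ is a free pair if and only if $\chi(ab)$ is a free point for some irreducible complex character $\chi$ of $G$; (2) the group $\langle 1+a,1+b\rangle$ is nilpotent if and only if $\chi(ab)=0$ for every irreducible complex character $\chi$ of $G$. -/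

import Mathlib

/-- `(u, v)` is a free pair: `u` and `v` are free generators of a (necessarily non-abelian) free
group, i.e. no non-trivial reduced word in two letters vanishes at `(u, v)`. -/
def IsFreePair {H : Type*} [Group H] (u v : H) : Prop :=
  Function.Injective (FreeGroup.lift (![u, v] : Fin 2 → H))

/-- A complex number `z` is a free point if the matrices with rows `(1, 1), (0, 1)` and
`(1, 0), (z, 1)` form a free pair. -/
def IsFreePoint (z : ℂ) : Prop :=
  IsFreePair (H := Matrix.SpecialLinearGroup (Fin 2) ℂ)
    ⟨!![1, 1; 0, 1], by simp [Matrix.det_fin_two]⟩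
    ⟨!![1, 0; z, 1], by simp [Matrix.det_fin_two]⟩

/-- The unit `1 + a`, with inverse `1 - a`, attached to an element `a` of square zero. -/
def oneAddUnit {R : Type*} [Ring R] (a : R) (ha : a ^ 2 = 0) : Rˣ where
  val := 1 + a
  inv := 1 - a
  val_inv := by
    have h : (1 + a) * (1 - a) = 1 - a ^ 2 := by noncomm_ring
    rw [h, ha, sub_zero]
  inv_val := by
    have h : (1 - a) * (1 + a) = 1 - a ^ 2 := by noncomm_ring
    rw [h, ha, sub_zero]

/-- `χ : G → ℂ` is an irreducible complex character of `G`: it is the character of an irreducible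
finite-dimensional complex representation (realised on some `ℂⁿ`). -/
def IsIrreducibleCharacter {G : Type*} [Group G] (χ : G → ℂ) : Prop :=
  ∃ (n : ℕ) (ρ : Representation ℂ G (Fin n → ℂ)), ρ.IsIrreducible ∧ χ = ρ.character

/-- The value at `x = ∑ g, x_g g` of the `ℂ`-linear extension of `χ : G → ℂ` to the group algebra,
namely `∑ g, x_g χ(g)`. -/
noncomputable def charEval {G : Type*} (χ : G → ℂ) (x : MonoidAlgebra ℂ G) : ℂ :=
  x.coeff.sum fun g c => c * χ g

/-! Irreducible representations embed `ℂG` in a finite product of matrix algebras of size at most 3.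
There a square-zero matrix has rank at most one, so in each block `aba = za` and `bab = zb` with `z
= tr(ab) = χ(ab)`. If `z ≠ 0`, then `a` and `b` span a copy of the 2 × 2 matrices, and `SL₂` embeds
in the units, carrying the standard pair with parameter `z` to `(1 + a, 1 + b)`. The block is then
free exactly when `z` is a free point, and it is never nilpotent. If `z = 0`, then `1 + a` and `1 +
b` commute with their commutator. Freeness in one block lifts to `ℂG`. Conversely, if no block is
free, the kernels in the free group are finitely many non-trivial normal subgroups; they share a
non-trivial word, which is then trivial in `ℂG`. -/

open scoped commutatorElement

/-! ### Normal subgroups of the free group of rank two -/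

/-- A non-trivial element of a free group of rank two has a conjugate whose reduced word starts
with a given letter `s` and ends with the inverse of `s`. -/
theorem FreeGroup.exists_conj_toWord_eq {w : FreeGroup (Fin 2)} (hw : w ≠ 1) (s : Fin 2 × Bool) :
    ∃ (p : FreeGroup (Fin 2)) (L : List (Fin 2 × Bool)),
      (p * w * p⁻¹).toWord = s :: L ++ [(s.1, !s.2)] := by
  have hne : w.toWord ≠ [] := fun h => hw (FreeGroup.toWord_eq_nil_iff.1 h)
  have hred : FreeGroup.IsReduced w.toWord := FreeGroup.isReduced_toWord
  -- In `s q w q⁻¹ s⁻¹`, avoiding cancellation forbids at most three of the four letters for `q`.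
  obtain ⟨q, hq1, hq2, hq3⟩ : ∃ q : Fin 2 × Bool,
      q ≠ ((w.toWord.head hne).1, !(w.toWord.head hne).2) ∧ q ≠ w.toWord.getLast hne ∧
        q ≠ (s.1, !s.2) := by
    generalize w.toWord.head hne = x
    generalize w.toWord.getLast hne = y
    revert x y s
    decide
  have hmk : FreeGroup.mk [s, q] * w * (FreeGroup.mk [s, q])⁻¹ =
      FreeGroup.mk ([s, q] ++ w.toWord ++ [(q.1, !q.2), (s.1, !s.2)]) := by
    conv_lhs => rw [← FreeGroup.mk_toWord (x := w)]
    simp [FreeGroup.mul_mk, FreeGroup.inv_mk, FreeGroup.invRev]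
  refine ⟨FreeGroup.mk [s, q], q :: w.toWord ++ [(q.1, !q.2)], ?_⟩
  rw [hmk, FreeGroup.toWord_mk, FreeGroup.IsReduced.reduce_eq]
  · simp
  · have hh : w.toWord.head? = some (w.toWord.head hne) := List.head?_eq_some_head hne
    have hl : w.toWord.getLast? = some (w.toWord.getLast hne) := List.getLast?_eq_some_getLast hne
    have key : ∀ x y : Fin 2 × Bool, y ≠ (x.1, !x.2) → x.1 = y.1 → x.2 = y.2 := by decide
    have key' : ∀ x y : Fin 2 × Bool, y ≠ x → x.1 = y.1 → x.2 = !y.2 := by decide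
    have key'' : ∀ x y : Fin 2 × Bool, y ≠ (x.1, !x.2) → y.1 = x.1 → y.2 = x.2 := by decide
    unfold FreeGroup.IsReduced at hred ⊢
    rw [List.append_assoc, List.isChain_append, List.isChain_append]
    refine ⟨?_, ⟨hred, ?_, ?_⟩, ?_⟩
    · simpa using key s q hq3
    · simpa using fun h => (key s q hq3 h.symm).symm
    · rw [hl]
      simpa using key' _ q hq2
    · rw [List.head?_append, hh]
      simpa using key'' _ q hq1

/-- In a free group of rank two, any two non-trivial normal subgroups meet non-trivially. -/
theorem FreeGroup.inf_ne_bot_of_normal {M N : Subgroup (FreeGroup (Fin 2))} [hM : M.Normal]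
    [hN : N.Normal] (hM1 : M ≠ ⊥) (hN1 : N ≠ ⊥) : M ⊓ N ≠ ⊥ := by
  intro h
  obtain ⟨u, hu, hu1⟩ := M.bot_or_exists_ne_one.resolve_left hM1
  obtain ⟨v, hv, hv1⟩ := N.bot_or_exists_ne_one.resolve_left hN1
  -- With these end letters neither product of the two conjugates cancels, and the two products
  -- start with different letters, so the conjugates cannot commute.
  obtain ⟨p, K, hK⟩ := FreeGroup.exists_conj_toWord_eq hu1 (0, true)
  obtain ⟨q, L, hL⟩ := FreeGroup.exists_conj_toWord_eq hv1 (1, true)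
  have hcomm : Commute _ _ := Subgroup.commute_of_normal_of_disjoint M N hM hN
    (disjoint_iff.2 h) _ _ (hM.conj_mem _ hu p) (hN.conj_mem _ hv q)
  generalize p * u * p⁻¹ = u' at hK hcomm
  generalize q * v * q⁻¹ = v' at hL hcomm
  have key := congrArg FreeGroup.toWord hcomm.eq
  have hr1 := FreeGroup.isReduced_toWord (x := u')
  have hr2 := FreeGroup.isReduced_toWord (x := v')
  rw [FreeGroup.toWord_mul, FreeGroup.toWord_mul, FreeGroup.IsReduced.reduce_eq,
    FreeGroup.IsReduced.reduce_eq, hK, hL] at key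
  · simp at key
  all_goals
    unfold FreeGroup.IsReduced at *
    rw [hK] at *
    rw [hL] at *
    rw [List.isChain_append]
    exact ⟨by assumption, by assumption, by simp [List.getLast?_cons]⟩

/-- In a free group of rank two, finitely many non-trivial normal subgroups meet non-trivially. -/
theorem FreeGroup.exists_ne_one_forall_mem {ι : Type*} [Finite ι]
    (N : ι → Subgroup (FreeGroup (Fin 2))) [∀ i, (N i).Normal] (hN : ∀ i, N i ≠ ⊥) :
    ∃ w ≠ 1, ∀ i, w ∈ N i := by
  have := Fintype.ofFinite ι
  have key (s : Finset ι) : (s.inf N).Normal ∧ s.inf N ≠ ⊥ := by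
    classical
    induction s using Finset.induction_on with
    | empty =>
      rw [Finset.inf_empty]
      exact ⟨inferInstance, top_ne_bot⟩
    | insert i s _ ih =>
      have := ih.1
      rw [Finset.inf_insert]
      exact ⟨inferInstance, FreeGroup.inf_ne_bot_of_normal (hN i) ih.2⟩
  obtain ⟨w, hw⟩ := Subgroup.ne_bot_iff_exists_ne_one.1 (key Finset.univ).2
  exact ⟨w, fun h => hw (Subtype.ext h), fun i =>
    (Finset.inf_le (Finset.mem_univ i) : Finset.univ.inf N ≤ N i) w.2⟩

/-- This word witnesses non-freeness when the parameter is zero. -/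
theorem FreeGroup.commutator_commutator_ne_one :
    ⁅⁅FreeGroup.of (0 : Fin 2), FreeGroup.of (1 : Fin 2)⁆, FreeGroup.of (0 : Fin 2)⁆ ≠ 1 := by
  decide

open Matrix

/-! ### Nilpotent case: `aba = bab = 0` -/

section SquareZero

variable {R : Type*} [Ring R] {a b : R}

theorem commutator_oneAddUnit_eq (ha : a ^ 2 = 0) (hb : b ^ 2 = 0) (hab : a * b * a = 0)
    (hba : b * a * b = 0) :
    (⁅oneAddUnit a ha, oneAddUnit b hb⁆ : Rˣ) = 1 + a * b - b * a := by
  have ha' : a * a = 0 := by rw [← sq, ha]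
  have hb' : b * b = 0 := by rw [← sq, hb]
  have h1 : a * (b * a) = 0 := by rw [← mul_assoc, hab]
  have h2 : b * (a * b) = 0 := by rw [← mul_assoc, hba]
  change (1 + a) * (1 + b) * (1 - a) * (1 - b) = _
  simp only [mul_add, add_mul, mul_sub, sub_mul, mul_one, one_mul, mul_assoc, ha', hb', h1, h2,
    mul_zero, add_zero]
  abel

theorem commute_commutator_oneAddUnit_left (ha : a ^ 2 = 0) (hb : b ^ 2 = 0)
    (hab : a * b * a = 0) (hba : b * a * b = 0) :
    Commute ⁅oneAddUnit a ha, oneAddUnit b hb⁆ (oneAddUnit a ha) := by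
  have ha' : a * a = 0 := by rw [← sq, ha]
  apply Units.ext
  rw [Units.val_mul, Units.val_mul, commutator_oneAddUnit_eq ha hb hab hba]
  change (1 + a * b - b * a) * (1 + a) = (1 + a) * (1 + a * b - b * a)
  have h1 : a * (b * a) = 0 := by rw [← mul_assoc, hab]
  have h3 : a * (a * b) = 0 := by rw [← mul_assoc, ha', zero_mul]
  simp only [mul_add, add_mul, mul_sub, sub_mul, mul_one, one_mul, mul_assoc, ha', h1, h3,
    mul_zero, sub_zero, add_zero]
  abel

theorem commute_commutator_oneAddUnit_right (ha : a ^ 2 = 0) (hb : b ^ 2 = 0)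
    (hab : a * b * a = 0) (hba : b * a * b = 0) :
    Commute ⁅oneAddUnit a ha, oneAddUnit b hb⁆ (oneAddUnit b hb) := by
  rw [← commutatorElement_inv, Commute.inv_left_iff]
  exact commute_commutator_oneAddUnit_left hb ha hba hab

end SquareZero

/-- A group generated by two elements that commute with their commutator is nilpotent. -/
theorem Subgroup.isNilpotent_closure_pair {H : Type*} [Group H] {x y : H}
    (hx : Commute ⁅x, y⁆ x) (hy : Commute ⁅x, y⁆ y) :
    Group.IsNilpotent (Subgroup.closure ({x, y} : Set H)) := by
  set K := Subgroup.closure ({x, y} : Set H) with hK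
  let x' : K := ⟨x, Subgroup.subset_closure (by simp)⟩
  let y' : K := ⟨y, Subgroup.subset_closure (by simp)⟩
  have htop : Subgroup.closure ({x', y'} : Set K) = ⊤ := by
    apply Subgroup.map_injective K.subtype_injective
    rw [MonoidHom.map_closure, Set.image_pair, ← MonoidHom.range_eq_map, Subgroup.range_subtype]
    rfl
  have hc : ⁅x', y'⁆ ∈ Subgroup.center K := by
    rw [← Subgroup.centralizer_univ, ← Subgroup.coe_top, ← htop, Subgroup.centralizer_closure,
      Subgroup.mem_centralizer_iff]
    rintro h (rfl | rfl)
    · exact Subtype.ext hx.eq.symm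
    · exact Subtype.ext hy.eq.symm
  -- Modulo the centre the two generators commute, so the quotient is abelian.
  apply Group.of_quotient_center_nilpotent
  let π := QuotientGroup.mk' (Subgroup.center K)
  have hπ : Commute (π x') (π y') := by
    rw [← commutatorElement_eq_one_iff_commute, ← map_commutatorElement]
    exact (QuotientGroup.eq_one_iff _).2 hc
  have htop' : Subgroup.closure ({π x', π y'} : Set (K ⧸ Subgroup.center K)) = ⊤ := by
    rw [← Set.image_pair, ← MonoidHom.map_closure, htop, ← MonoidHom.range_eq_map]
    exact MonoidHom.range_eq_top.2 (QuotientGroup.mk'_surjective _)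
  have hcomm : ∀ g h : K ⧸ Subgroup.center K, g * h = h * g := by
    have := Subgroup.isMulCommutative_closure (k := ({π x', π y'} : Set _)) (by
      rintro g (rfl | rfl) h (rfl | rfl)
      exacts [rfl, hπ.eq, hπ.eq.symm, rfl])
    rw [htop'] at this
    intro g h
    exact congrArg Subtype.val (this.is_comm.comm (⟨g, trivial⟩ : (⊤ : Subgroup _)) ⟨h, trivial⟩)
  let _ : CommGroup (K ⧸ Subgroup.center K) := { (inferInstance : Group _) with mul_comm := hcomm }
  exact CommGroup.isNilpotent

/-- Nilpotent groups satisfy an Engel identity. -/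
theorem Group.IsNilpotent.exists_iterate_commutator_eq_one {H : Type*} [Group H]
    (hH : Group.IsNilpotent H) (x y : H) : ∃ n, (fun g => ⁅g, x⁆)^[n] y = 1 := by
  obtain ⟨n, hn⟩ := Subgroup.nilpotent_iff_lowerCentralSeries.1 hH
  have key (m : ℕ) : (fun g => ⁅g, x⁆)^[m] y ∈ Subgroup.lowerCentralSeries (⊤ : Subgroup H) m := by
    induction m with
    | zero => simp
    | succ m ih =>
      rw [Function.iterate_succ_apply']
      exact Subgroup.commutator_mem_commutator ih (Subgroup.mem_top x)
  exact ⟨n, Subgroup.mem_bot.1 (hn ▸ key n)⟩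

/-! ### The standard pair in `SL₂` -/

/-- The matrix with rows `(1, 1), (0, 1)`. -/
def upperUnipotent : SpecialLinearGroup (Fin 2) ℂ :=
  ⟨!![1, 1; 0, 1], by simp [Matrix.det_fin_two]⟩

/-- The matrix with rows `(1, 0), (z, 1)`. -/
def lowerUnipotent (z : ℂ) : SpecialLinearGroup (Fin 2) ℂ :=
  ⟨!![1, 0; z, 1], by simp [Matrix.det_fin_two]⟩

/-- Each commutation with `upperUnipotent` replaces the lower left entry by minus its square, so it
never vanishes. -/
theorem iterate_commutator_upperUnipotent_ne_one {z : ℂ} (hz : z ≠ 0) (n : ℕ) :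
    (fun g => ⁅g, upperUnipotent⁆)^[n] (lowerUnipotent z) ≠ 1 := by
  have key : ((fun g => ⁅g, upperUnipotent⁆)^[n] (lowerUnipotent z)).1 1 0 ≠ 0 := by
    induction n with
    | zero => exact hz
    | succ n ih =>
      rw [Function.iterate_succ_apply']
      generalize (fun g => ⁅g, upperUnipotent⁆)^[n] (lowerUnipotent z) = g at ih
      have : (⁅g, upperUnipotent⁆).1 1 0 = -(g.1 1 0) ^ 2 := by
        rw [commutatorElement_def]
        have h1 : (g * upperUnipotent * g⁻¹ * upperUnipotent⁻¹).1 =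
          g.1 * !![1, 1; 0, 1] * g.1.adjugate * (!![1, 1; 0, 1] : Matrix _ _ ℂ).adjugate := rfl
        rw [h1]
        simp [Matrix.adjugate_fin_two, Matrix.mul_apply, Fin.sum_univ_two]
        ring
      rw [this]
      exact neg_ne_zero.2 (pow_ne_zero 2 ih)
  intro h
  rw [h] at key
  simp at key

theorem IsFreePoint.ne_zero {z : ℂ} (hz : IsFreePoint z) : z ≠ 0 := by
  rintro rfl
  have h : FreeGroup.of (1 : Fin 2) = 1 := by
    apply hz
    rw [map_one, FreeGroup.lift_apply_of]
    ext i j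
    fin_cases i <;> fin_cases j <;> rfl
  exact FreeGroup.of_ne_one _ h

/-! ### Embedding `SL₂` in the units -/

section Embedding

variable {R : Type*} [Ring R] [Algebra ℂ R] {a b : R} {z : ℂ}

/-- Two square-zero elements with `aba = za`, `bab = zb` span a copy of the algebra of
two by two matrices, if `z ≠ 0`. This is the resulting homomorphism from `SL₂`. -/
noncomputable def slHom (ha : a ^ 2 = 0) (hb : b ^ 2 = 0) (hab : a * b * a = z • a)
    (hba : b * a * b = z • b) (hz : z ≠ 0) : SpecialLinearGroup (Fin 2) ℂ →* R where
  -- The matrix units are `z⁻¹ab`, `a`, `z⁻¹b`, `z⁻¹ba`; the diagonal ones need not sum to `1`, and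
  -- the complementary idempotent is left fixed.
  toFun m := 1 + (m.1 0 0 - 1) • (z⁻¹ • (a * b)) + m.1 0 1 • a + m.1 1 0 • (z⁻¹ • b) +
    (m.1 1 1 - 1) • (z⁻¹ • (b * a))
  map_one' := by simp
  map_mul' m n := by
    have ha' : a * a = 0 := by rw [← sq, ha]
    have hb' : b * b = 0 := by rw [← sq, hb]
    have h1 : a * (b * a) = z • a := by rw [← mul_assoc, hab]
    have h2 : b * (a * b) = z • b := by rw [← mul_assoc, hba]
    have h3 : a * (a * b) = 0 := by rw [← mul_assoc, ha', zero_mul]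
    have h4 : b * (b * a) = 0 := by rw [← mul_assoc, hb', zero_mul]
    have hmn (i j : Fin 2) : (m * n).1 i j = m.1 i 0 * n.1 0 j + m.1 i 1 * n.1 1 j := by
      change (m.1 * n.1) i j = _
      rw [Matrix.mul_apply, Fin.sum_univ_two]
    simp only [hmn, mul_add, add_mul,
      mul_one, one_mul, smul_mul_assoc, mul_smul_comm, mul_assoc, ha', hb', h1, h2, h3, h4,
      smul_zero, mul_zero]
    match_scalars <;> field_simp <;> ring

variable (ha : a ^ 2 = 0) (hb : b ^ 2 = 0) (hab : a * b * a = z • a) (hba : b * a * b = z • b)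
  (hz : z ≠ 0)

/-- Multiplying by `a` on both sides, on the left, then on the right isolates the coefficients of
`b`, `ba` and `ab` in turn. -/
theorem slHom_injective (ha0 : a ≠ 0) : Function.Injective (slHom ha hb hab hba hz) := by
  rw [injective_iff_map_eq_one]
  intro m hm
  have ha' : a * a = 0 := by rw [← sq, ha]
  have hb' : b * b = 0 := by rw [← sq, hb]
  have h1 : a * (b * a) = z • a := by rw [← mul_assoc, hab]
  have h3 : a * (a * b) = 0 := by rw [← mul_assoc, ha', zero_mul]
  have hm : (m.1 0 0 - 1) • (z⁻¹ • (a * b)) + m.1 0 1 • a + m.1 1 0 • (z⁻¹ • b) +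
    (m.1 1 1 - 1) • (z⁻¹ • (b * a)) = 0 := by
    have : 1 + (m.1 0 0 - 1) • (z⁻¹ • (a * b)) + m.1 0 1 • a + m.1 1 0 • (z⁻¹ • b) +
      (m.1 1 1 - 1) • (z⁻¹ • (b * a)) = 1 := hm
    simpa only [add_assoc, add_eq_left] using this
  have e10 : m.1 1 0 = 0 := by
    simpa [mul_add, add_mul, mul_assoc, ha', h1, h3, hz, ha0, smul_smul]
      using congrArg (fun x => a * x * a) hm
  have e11 : m.1 1 1 - 1 = 0 := by
    simpa [mul_add, ha', h1, h3, hz, ha0, e10, smul_smul] using congrArg (fun x => a * x) hm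
  have e00 : m.1 0 0 - 1 = 0 := by
    simpa [add_mul, mul_assoc, ha', h1, hz, ha0, e10, e11, smul_smul]
      using congrArg (fun x => x * a) hm
  have e01 : m.1 0 1 = 0 := by simpa [e00, e10, e11, ha0] using hm
  ext i j
  fin_cases i <;> fin_cases j
  exacts [sub_eq_zero.1 e00, e01, e10, sub_eq_zero.1 e11]

/-- If `aba = za`, `bab = zb` and `z ≠ 0` then `SL₂` embeds into the units in such a way that the
standard pair with parameter `z` is mapped to `(1 + a, 1 + b)`. -/
theorem exists_injective_specialLinearGroup_hom (ha0 : a ≠ 0) (hz : z ≠ 0)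
    (hab : a * b * a = z • a) (hba : b * a * b = z • b) :
    ∃ f : SpecialLinearGroup (Fin 2) ℂ →* Rˣ, Function.Injective f ∧
      f upperUnipotent = oneAddUnit a ha ∧ f (lowerUnipotent z) = oneAddUnit b hb := by
  refine ⟨(slHom ha hb hab hba hz).toHomUnits, fun m n h => ?_, ?_, ?_⟩
  · exact slHom_injective ha hb hab hba hz ha0 (congrArg Units.val h)
  · apply Units.ext
    change 1 + _ + _ + _ + _ = 1 + a
    simp [upperUnipotent]
  · apply Units.ext
    change 1 + _ + _ + _ + _ = 1 + b
    simp [lowerUnipotent, smul_smul, hz]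

end Embedding

/-! ### Square-zero matrices of size at most three -/

/-- A square-zero matrix of size at most three has rank at most one. -/
theorem Matrix.exists_eq_vecMulVec_of_sq_eq_zero {K : Type*} [Field K] {n : ℕ} (hn : n ≤ 3)
    {a : Matrix (Fin n) (Fin n) K} (ha : a ^ 2 = 0) : ∃ u v, a = vecMulVec u v := by
  -- Range inside kernel gives `2 · rank ≤ n ≤ 3`.
  have hle : LinearMap.range a.toLin' ≤ LinearMap.ker a.toLin' := by
    rintro _ ⟨x, rfl⟩
    rw [LinearMap.mem_ker, ← LinearMap.comp_apply, ← Matrix.toLin'_mul, ← sq, ha]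
    simp
  have h1 := Submodule.finrank_mono hle
  have h2 := LinearMap.finrank_range_add_finrank_ker a.toLin'
  rw [Module.finrank_fin_fun] at h2
  obtain ⟨u, hu⟩ := finrank_le_one_iff.1 (show Module.finrank K (LinearMap.range a.toLin') ≤ 1 by
    lia)
  choose v hv using fun j => hu ⟨a.toLin' (Pi.single j 1), LinearMap.mem_range_self _ _⟩
  refine ⟨u, v, ?_⟩
  ext i j
  have := congrFun (congrArg Subtype.val (hv j)) i
  simp at this
  rw [vecMulVec_apply, mul_comm, this]

/-- For `a = uvᵀ` the middle factor `vᵀbu` of `aba` is a scalar, equal to the trace of `ab`. -/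
theorem Matrix.mul_mul_self_of_sq_eq_zero {K : Type*} [Field K] {n : ℕ} (hn : n ≤ 3)
    {a : Matrix (Fin n) (Fin n) K} (ha : a ^ 2 = 0) (b : Matrix (Fin n) (Fin n) K) :
    a * b * a = (a * b).trace • a := by
  obtain ⟨u, v, rfl⟩ := Matrix.exists_eq_vecMulVec_of_sq_eq_zero hn ha
  rw [vecMulVec_mul, vecMulVec_mul_vecMulVec, trace_vecMulVec, dotProduct_comm u,
    vecMulVec_smul]

/-! ### Representations and the group algebra -/

/-- The matrix form of the algebra homomorphism attached to a representation on `ℂⁿ`. -/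
noncomputable def Representation.matrixAlgHom {G : Type*} [Group G] {n : ℕ}
    (ρ : Representation ℂ G (Fin n → ℂ)) : MonoidAlgebra ℂ G →ₐ[ℂ] Matrix (Fin n) (Fin n) ℂ :=
  (LinearMap.toMatrixAlgEquiv' : _ ≃ₐ[ℂ] Matrix (Fin n) (Fin n) ℂ).toAlgHom.comp ρ.asAlgebraHom

theorem charEval_character {G : Type*} [Group G] {n : ℕ} (ρ : Representation ℂ G (Fin n → ℂ))
    (x : MonoidAlgebra ℂ G) : charEval ρ.character x = (ρ.matrixAlgHom x).trace := by
  have h : (ρ.matrixAlgHom x).trace = LinearMap.trace ℂ (Fin n → ℂ) (ρ.asAlgebraHom x) := by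
    rw [LinearMap.trace_eq_matrix_trace ℂ (Pi.basisFun ℂ (Fin n))]
    rfl
  rw [h, Representation.asAlgebraHom_def, MonoidAlgebra.lift_apply, Finsupp.sum, map_sum, charEval,
    Finsupp.sum]
  simp [Representation.character]

/-- A rank-one endomorphism takes any non-zero vector to any prescribed one, so every non-zero
vector is cyclic. -/
theorem Representation.isIrreducible_of_surjective {G k V : Type*} [Group G] [Field k]
    [AddCommGroup V] [Module k V] [Nontrivial V] (ρ : Representation k G V)
    (h : Function.Surjective ρ.asAlgebraHom) : ρ.IsIrreducible := by
  rw [Representation.irreducible_iff_isSimpleModule_asModule]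
  have : Nontrivial ρ.asModule := inferInstanceAs (Nontrivial V)
  rw [isSimpleModule_iff_toSpanSingleton_surjective]
  have key (v w : V) (hv : v ≠ 0) : ∃ x, ρ.asAlgebraHom x v = w := by
    obtain ⟨f, hf⟩ := Module.Projective.exists_dual_eq_one k hv
    obtain ⟨x, hx⟩ := h (f.smulRight w)
    exact ⟨x, by rw [hx, LinearMap.smulRight_apply, hf, one_smul]⟩
  exact ⟨inferInstance, fun v hv w => key v w hv⟩

/-- The group algebra of a finite group embeds into a finite product of matrix algebras attached
to irreducible representations. -/
theorem exists_irreducible_representations_jointly_injective (G : Type*) [Group G] [Finite G] :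
    ∃ (m : ℕ) (d : Fin m → ℕ) (ρ : ∀ i, Representation ℂ G (Fin (d i) → ℂ)),
      (∀ i, (ρ i).IsIrreducible) ∧
        ∀ x y : MonoidAlgebra ℂ G, (∀ i, (ρ i).matrixAlgHom x = (ρ i).matrixAlgHom y) → x = y := by
  have := Fintype.ofFinite G
  obtain ⟨m, d, hd, ⟨e⟩⟩ := IsSemisimpleRing.exists_algEquiv_pi_matrix_of_isAlgClosed ℂ
    (MonoidAlgebra ℂ G)
  let π (i : Fin m) : MonoidAlgebra ℂ G →ₐ[ℂ] Module.End ℂ (Fin (d i) → ℂ) :=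
    (Matrix.toLinAlgEquiv' : Matrix (Fin (d i)) (Fin (d i)) ℂ ≃ₐ[ℂ] _).toAlgHom.comp
      ((Pi.evalAlgHom ℂ _ i).comp e.toAlgHom)
  let ρ (i : Fin m) : Representation ℂ G (Fin (d i) → ℂ) :=
    (π i : MonoidAlgebra ℂ G →* _).comp (MonoidAlgebra.of ℂ G)
  have hρ (i : Fin m) : (ρ i).asAlgebraHom = π i := by
    rw [Representation.asAlgebraHom_def]
    exact (MonoidAlgebra.lift ℂ _ G).apply_symm_apply (π i)
  have hmat (i : Fin m) (x : MonoidAlgebra ℂ G) : (ρ i).matrixAlgHom x = e x i := by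
    change LinearMap.toMatrixAlgEquiv' ((ρ i).asAlgebraHom x) = _
    rw [hρ]
    exact LinearMap.toMatrixAlgEquiv'_toLinAlgEquiv' _
  refine ⟨m, d, ρ, fun i => ?_, fun x y h => e.injective (funext fun i => ?_)⟩
  · apply Representation.isIrreducible_of_surjective
    rw [hρ]
    exact Matrix.toLinAlgEquiv'.surjective.comp
      ((Function.surjective_eval i).comp e.surjective)
  · rw [← hmat, ← hmat, h]

/-! ### Transfer of free pairs, and the main theorem -/

theorem map_oneAddUnit {R S : Type*} [Ring R] [Ring S] (f : R →+* S) {a : R} (ha : a ^ 2 = 0)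
    (ha' : f a ^ 2 = 0) : Units.map (f : R →* S) (oneAddUnit a ha) = oneAddUnit (f a) ha' :=
  Units.ext (by simp [oneAddUnit])

theorem FreeGroup.map_lift_pair {H K : Type*} [Group H] [Group K] (f : H →* K) (u v : H)
    (w : FreeGroup (Fin 2)) :
    f (FreeGroup.lift (![u, v] : Fin 2 → H) w) = FreeGroup.lift (![f u, f v] : Fin 2 → K) w := by
  have : f.comp (FreeGroup.lift ![u, v]) = FreeGroup.lift ![f u, f v] := by
    ext i
    fin_cases i <;> simp
  exact DFunLike.congr_fun this w

theorem IsFreePair.of_map {H K : Type*} [Group H] [Group K] (f : H →* K) {u v : H}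
    (h : IsFreePair (f u) (f v)) : IsFreePair u v := fun w w' hw => h (by
  rw [← FreeGroup.map_lift_pair, ← FreeGroup.map_lift_pair, hw])

theorem IsFreePair.map {H K : Type*} [Group H] [Group K] {f : H →* K}
    (hf : Function.Injective f) {u v : H} (h : IsFreePair u v) : IsFreePair (f u) (f v) :=
  fun w w' hw => h (hf (by rw [FreeGroup.map_lift_pair, FreeGroup.map_lift_pair, hw]))

theorem isFreePair_iff_ker_eq_bot {H : Type*} [Group H] {u v : H} :
    IsFreePair u v ↔ (FreeGroup.lift (![u, v] : Fin 2 → H)).ker = ⊥ :=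
  (MonoidHom.ker_eq_bot_iff _).symm

section MatrixPair

variable {n : ℕ} {a b : Matrix (Fin n) (Fin n) ℂ}

theorem Matrix.exists_injective_specialLinearGroup_hom (hn : n ≤ 3) (ha : a ^ 2 = 0)
    (hb : b ^ 2 = 0) (hz : (a * b).trace ≠ 0) :
    ∃ f : SpecialLinearGroup (Fin 2) ℂ →* (Matrix (Fin n) (Fin n) ℂ)ˣ, Function.Injective f ∧
      f upperUnipotent = oneAddUnit a ha ∧
        f (lowerUnipotent (a * b).trace) = oneAddUnit b hb := by
  refine _root_.exists_injective_specialLinearGroup_hom ha hb ?_ hz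
    (Matrix.mul_mul_self_of_sq_eq_zero hn ha b) ?_
  · rintro rfl
    simp at hz
  · rw [Matrix.mul_mul_self_of_sq_eq_zero hn hb a, trace_mul_comm]

/-- For square-zero matrices of size at most three, `(1 + a, 1 + b)` is a free pair if and only if
the trace of `ab` is a free point. -/
theorem Matrix.isFreePair_oneAddUnit_iff (hn : n ≤ 3) (ha : a ^ 2 = 0) (hb : b ^ 2 = 0) :
    IsFreePair (oneAddUnit a ha) (oneAddUnit b hb) ↔ IsFreePoint (a * b).trace := by
  by_cases hz : (a * b).trace = 0
  · refine iff_of_false (fun h => ?_) fun h => h.ne_zero hz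
    have hab : a * b * a = 0 := by
      rw [Matrix.mul_mul_self_of_sq_eq_zero hn ha, hz, zero_smul]
    have hba : b * a * b = 0 := by
      rw [Matrix.mul_mul_self_of_sq_eq_zero hn hb, trace_mul_comm, hz, zero_smul]
    refine FreeGroup.commutator_commutator_ne_one (h ?_)
    rw [map_one, map_commutatorElement, map_commutatorElement, commutatorElement_eq_one_iff_commute]
    simpa using commute_commutator_oneAddUnit_left ha hb hab hba
  · obtain ⟨f, hf, hfa, hfb⟩ := Matrix.exists_injective_specialLinearGroup_hom hn ha hb hz
    rw [← hfa, ← hfb]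
    exact ⟨IsFreePair.of_map f, IsFreePair.map hf⟩

end MatrixPair

theorem map_iterate_commutator {H K : Type*} [Group H] [Group K] (φ : H →* K) (x y : H) (k : ℕ) :
    φ ((fun g => ⁅g, x⁆)^[k] y) = (fun g => ⁅g, φ x⁆)^[k] (φ y) :=
  (Function.Semiconj.iterate_right (f := φ) (ga := fun g => ⁅g, x⁆) (gb := fun g => ⁅g, φ x⁆)
    (fun g => map_commutatorElement φ g x) k) y

theorem mainTheorem9 {G : Type*} [Group G] [Finite G]
    (hdeg : ∀ χ : G → ℂ, IsIrreducibleCharacter χ → ∃ d : ℕ, d ≤ 3 ∧ χ 1 = (d : ℂ))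
    (a b : MonoidAlgebra ℂ G) (ha : a ^ 2 = 0) (hb : b ^ 2 = 0) :
    (IsFreePair (oneAddUnit a ha) (oneAddUnit b hb) ↔
      ∃ χ : G → ℂ, IsIrreducibleCharacter χ ∧ IsFreePoint (charEval χ (a * b))) ∧
    (Group.IsNilpotent
        (Subgroup.closure ({oneAddUnit a ha, oneAddUnit b hb} : Set (MonoidAlgebra ℂ G)ˣ)) ↔
      ∀ χ : G → ℂ, IsIrreducibleCharacter χ → charEval χ (a * b) = 0) := by
  have hle (n : ℕ) (ρ : Representation ℂ G (Fin n → ℂ)) (hρ : ρ.IsIrreducible) : n ≤ 3 := by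
    obtain ⟨d, hd, h⟩ := hdeg _ ⟨n, ρ, hρ, rfl⟩
    rw [Representation.char_one, Module.finrank_fin_fun, Nat.cast_inj] at h
    exact h ▸ hd
  have hsq {n : ℕ} (ρ : Representation ℂ G (Fin n → ℂ)) {x : MonoidAlgebra ℂ G} (hx : x ^ 2 = 0) :
      ρ.matrixAlgHom x ^ 2 = 0 := by rw [← map_pow, hx, map_zero]
  let F {n : ℕ} (ρ : Representation ℂ G (Fin n → ℂ)) :
      (MonoidAlgebra ℂ G)ˣ →* (Matrix (Fin n) (Fin n) ℂ)ˣ :=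
    Units.map ((ρ.matrixAlgHom : MonoidAlgebra ℂ G →+* Matrix (Fin n) (Fin n) ℂ) : _ →* _)
  have hF {n : ℕ} (ρ : Representation ℂ G (Fin n → ℂ)) {x : MonoidAlgebra ℂ G} (hx : x ^ 2 = 0) :
      F ρ (oneAddUnit x hx) = oneAddUnit (ρ.matrixAlgHom x) (hsq ρ hx) :=
    map_oneAddUnit _ hx _
  obtain ⟨m, d, ρ, hirr, hinj⟩ := exists_irreducible_representations_jointly_injective G
  refine ⟨⟨fun h => ?_, ?_⟩, ⟨?_, fun h => ?_⟩⟩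
  · by_contra! hno
    obtain ⟨w, hw1, hw⟩ := FreeGroup.exists_ne_one_forall_mem
      (fun i => (FreeGroup.lift ![F (ρ i) (oneAddUnit a ha), F (ρ i) (oneAddUnit b hb)]).ker)
      fun i => by
        rw [Ne, ← isFreePair_iff_ker_eq_bot, hF, hF,
          Matrix.isFreePair_oneAddUnit_iff (hle _ _ (hirr i)), ← map_mul, ← charEval_character]
        exact hno _ ⟨_, _, hirr i, rfl⟩
    refine hw1 (h ?_)
    rw [map_one]
    refine Units.ext (hinj _ _ fun i => ?_)
    have := hw i
    rw [MonoidHom.mem_ker, ← FreeGroup.map_lift_pair] at this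
    simpa [F] using congrArg Units.val this
  · rintro ⟨_, ⟨n, σ, hσ, rfl⟩, hz⟩
    apply IsFreePair.of_map (F σ)
    rw [hF, hF, Matrix.isFreePair_oneAddUnit_iff (hle _ _ hσ), ← map_mul, ← charEval_character]
    exact hz
  · rintro hnil _ ⟨n, σ, hσ, rfl⟩
    by_contra hz
    rw [charEval_character, map_mul] at hz
    obtain ⟨f, hf, hfa, hfb⟩ := Matrix.exists_injective_specialLinearGroup_hom (hle _ _ hσ)
      (hsq σ ha) (hsq σ hb) hz
    -- An Engel identity in the nilpotent group passes to the block and, by injectivity of `f`, back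
    -- to `SL₂`, where it fails.
    obtain ⟨k, hk⟩ := hnil.exists_iterate_commutator_eq_one
      ⟨oneAddUnit a ha, Subgroup.subset_closure (by simp)⟩
      ⟨oneAddUnit b hb, Subgroup.subset_closure (by simp)⟩
    apply iterate_commutator_upperUnipotent_ne_one hz k
    apply hf
    rw [map_iterate_commutator, hfa, hfb, map_one, ← hF σ ha, ← hF σ hb, ← map_iterate_commutator]
    have := congrArg (Subgroup.subtype _) hk
    rw [map_iterate_commutator, map_one] at this
    exact (congrArg (F σ) this).trans (map_one _)
  · have hz (i : Fin m) : ((ρ i).matrixAlgHom a * (ρ i).matrixAlgHom b).trace = 0 := by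
      rw [← map_mul, ← charEval_character]
      exact h _ ⟨_, _, hirr i, rfl⟩
    have hab : a * b * a = 0 := hinj _ _ fun i => by
      rw [map_mul, map_mul, Matrix.mul_mul_self_of_sq_eq_zero (hle _ _ (hirr i)) (hsq _ ha), hz,
        zero_smul, map_zero]
    have hba : b * a * b = 0 := hinj _ _ fun i => by
      rw [map_mul, map_mul, Matrix.mul_mul_self_of_sq_eq_zero (hle _ _ (hirr i)) (hsq _ hb),
        trace_mul_comm, hz, zero_smul, map_zero]
    exact Subgroup.isNilpotent_closure_pair (commute_commutator_oneAddUnit_left ha hb hab hba)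
      (commute_commutator_oneAddUnit_right ha hb hab hba)
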